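/- Let $K$ be a field, $S=K[x_1,\dots,x_n]$, $\mathfrak m=(x_1,\dots,x_n)$, and let $I\subset S$ be an equigenerated monomial ideal, that is, an ideal generated by monomials that can also be generated by homogeneous polynomials of one and the same degree (equivalently, by monomials of one and the same degree). Let $\mathcal R(I)=\bigoplus_{k\ge 0}I^kt^k\subset S[t]$ be the Rees ring of $I$, let $F(I)=\mathcal R(I)/\mathfrak m\mathcal R(I)=\bigoplus_{k\ge 0}(I^k/\mathfrak m I^k)t^k$ be its fiber ring, and let $\ell(I)=\dim F(I)$ be the Krull dimension of $F(I)$ (the analytic spread of $I$). Write the Hilbert series of the standard graded $K$-algebra $F(I)$ as \[ \sum_{k\ge 0}\dim_K\bigl(I^k/\mathfrak m I^k\bigr)\,t^k=\frac{Q(t)}{(1-t)^{\ell(I)}},\qquad Q(t)=\sum_{i\ge 0}h_it^i, \] so that $(h_0,h_1,h_2,\dots)$ is the $h$-vector of $F(I)$. Then $h_2\ge 0$. -/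

import Mathlib

noncomputable section

open MvPolynomial

/-- A monomial ideal: an ideal generated by a set of monomials `x ^ a`, `a ∈ A`. -/
def IsMonomialIdeal {K : Type*} [Field K] {n : ℕ} (I : Ideal (MvPolynomial (Fin n) K)) : Prop :=
  ∃ A : Set (Fin n →₀ ℕ), I = Ideal.span ((fun a => monomial a (1 : K)) '' A)

/-- An equigenerated ideal: an ideal generated by homogeneous polynomials of one degree `d`. -/
def IsEquigenerated {K : Type*} [Field K] {n : ℕ} (I : Ideal (MvPolynomial (Fin n) K)) : Prop :=
  ∃ (d : ℕ) (G : Set (MvPolynomial (Fin n) K)),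
    (∀ f ∈ G, f.IsHomogeneous d) ∧ I = Ideal.span G

/-- The extension `𝔪 R(I)` of `𝔪 = (x₁, …, xₙ)` to the Rees ring `R(I) = ⨁ Iᵏ tᵏ ⊆ S[t]`. -/
abbrev irrelevantReesIdeal {K : Type*} [Field K] {n : ℕ} (I : Ideal (MvPolynomial (Fin n) K)) :
    Ideal (reesAlgebra I) :=
  (idealOfVars (Fin n) K).map (algebraMap (MvPolynomial (Fin n) K) (reesAlgebra I))

/-- The fiber ring `F(I) = R(I) / 𝔪 R(I)`. -/
abbrev FiberRing {K : Type*} [Field K] {n : ℕ} (I : Ideal (MvPolynomial (Fin n) K)) : Type _ :=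
  reesAlgebra I ⧸ irrelevantReesIdeal I

/-- The `k`-th graded component `Iᵏ tᵏ` of the Rees ring. -/
def reesComponent {K : Type*} [Field K] {n : ℕ} (I : Ideal (MvPolynomial (Fin n) K)) (k : ℕ) :
    Submodule K (reesAlgebra I) where
  carrier := {f | ∃ r ∈ I ^ k, (f : Polynomial (MvPolynomial (Fin n) K)) = Polynomial.monomial k r}
  zero_mem' := ⟨0, zero_mem _, by simp⟩
  add_mem' := by
    rintro f g ⟨r, hr, hf⟩ ⟨s, hs, hg⟩
    exact ⟨r + s, add_mem hr hs, by simp [hf, hg]⟩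
  smul_mem' := by
    rintro c f ⟨r, hr, hf⟩
    exact ⟨c • r, Submodule.smul_of_tower_mem _ c hr, by
      rw [← Polynomial.smul_monomial, ← hf]; rfl⟩

/-- The `k`-th graded component of the fiber ring, the image of `Iᵏ tᵏ` in `F(I)`. -/
def fiberComponent {K : Type*} [Field K] {n : ℕ} (I : Ideal (MvPolynomial (Fin n) K)) (k : ℕ) :
    Submodule K (FiberRing I) :=
  (reesComponent I k).map (Ideal.Quotient.mkₐ K (irrelevantReesIdeal I)).toLinearMap

/-- The Hilbert series of the fiber ring. -/
def fiberHilbertSeries {K : Type*} [Field K] {n : ℕ} (I : Ideal (MvPolynomial (Fin n) K)) :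
    PowerSeries ℤ :=
  PowerSeries.mk fun k => (Module.finrank K (fiberComponent I k) : ℤ)

/-- The analytic spread of `I`, that is, the Krull dimension of the fiber ring, as a natural number.
It is the true dimension: see `coe_analyticSpread`. -/
def analyticSpread {K : Type*} [Field K] {n : ℕ} (I : Ideal (MvPolynomial (Fin n) K)) : ℕ :=
  ((ringKrullDim (FiberRing I)).unbotD 0).toNat

/-- The `i`-th entry `hᵢ` of the `h`-vector of the fiber ring: the coefficient of `tⁱ` in
`Q(t) = (1 - t) ^ ℓ(I) * Hilb_{F(I)}(t)`. -/
def fiberHVector {K : Type*} [Field K] {n : ℕ} (I : Ideal (MvPolynomial (Fin n) K)) (i : ℕ) : ℤ :=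
  PowerSeries.coeff i ((1 - PowerSeries.X) ^ analyticSpread I * fiberHilbertSeries I)

theorem fiberRing_nontrivial {K : Type*} [Field K] {n : ℕ} (I : Ideal (MvPolynomial (Fin n) K)) :
    Nontrivial (FiberRing I) := by
  refine Ideal.Quotient.nontrivial_iff.mpr fun h => ?_
  let φ : reesAlgebra I →+* K :=
    ((constantCoeff (R := K) (σ := Fin n)).comp Polynomial.constantCoeff).comp
      (reesAlgebra I).val.toRingHom
  have hle : irrelevantReesIdeal I ≤ RingHom.ker φ := by
    rw [irrelevantReesIdeal, Ideal.map_le_iff_le_comap, idealOfVars, Ideal.span_le]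
    rintro _ ⟨i, rfl⟩
    change φ _ = 0
    simp [φ]
  have h1 : (1 : reesAlgebra I) ∈ RingHom.ker φ := hle (h ▸ Submodule.mem_top)
  simp [RingHom.mem_ker] at h1

theorem coe_analyticSpread {K : Type*} [Field K] {n : ℕ} (I : Ideal (MvPolynomial (Fin n) K)) :
    ((analyticSpread I : ℕ) : WithBot ℕ∞) = ringKrullDim (FiberRing I) := by
  have := fiberRing_nontrivial I
  have : Algebra.FiniteType K (reesAlgebra I) :=
    Algebra.FiniteType.trans (S := MvPolynomial (Fin n) K) inferInstance inferInstance
  obtain ⟨m, f, hf⟩ := (Algebra.FiniteType.iff_quotient_mvPolynomial'' (R := K)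
    (S := reesAlgebra I)).mp inferInstance
  have hle : ringKrullDim (FiberRing I) ≤ ringKrullDim (MvPolynomial (Fin m) K) :=
    ringKrullDim_le_of_surjective
      ((Ideal.Quotient.mk (irrelevantReesIdeal I)).comp f.toRingHom)
      (Ideal.Quotient.mk_surjective.comp hf)
  rw [MvPolynomial.ringKrullDim_of_isNoetherianRing, ringKrullDim_eq_zero_of_field] at hle
  have h0 : (0 : WithBot ℕ∞) ≤ ringKrullDim (FiberRing I) := ringKrullDim_nonneg_of_nontrivial
  rw [analyticSpread]
  generalize ringKrullDim (FiberRing I) = e at *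
  induction e with
  | bot => simp at h0
  | coe e =>
    induction e with
    | top =>
      rw [zero_add, Nat.card_fin] at hle
      exact absurd (top_le_iff.mp (WithBot.coe_le_coe.mp hle)) (ENat.natCast_ne_top m)
    | coe e => rfl

/-- If `Hilb_{F(I)}(t) = Q(t) / (1 - t) ^ ℓ(I)` with a polynomial `Q`, then `hᵢ` is the `i`-th
coefficient of `Q`. -/
theorem fiberHVector_eq_coeff {K : Type*} [Field K] {n : ℕ} (I : Ideal (MvPolynomial (Fin n) K))
    (Q : Polynomial ℤ)
    (hQ : fiberHilbertSeries I = (Q : PowerSeries ℤ) * PowerSeries.invOneSubPow ℤ (analyticSpread I))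
    (i : ℕ) : fiberHVector I i = Q.coeff i := by
  have h : (1 - PowerSeries.X : PowerSeries ℤ) ^ analyticSpread I
      * PowerSeries.invOneSubPow ℤ (analyticSpread I) = 1 := by
    rw [← PowerSeries.invOneSubPow_inv_eq_one_sub_pow]
    exact Units.inv_val _
  rw [fiberHVector, hQ, mul_left_comm, h, mul_one, Polynomial.coeff_coe]

end

/-! Let `X` be the exponents of the monomial generators of `I`, all of one degree, and let `q =
|X|`. As `I ^ 2` is generated by the monomials with exponents in `X + X`, the Hilbert function of
the fiber ring starts `1, q, |X + X|`. Expanding `(1 - t) ^ l` with `l = ℓ(I)` gives `h₂ = |X + X| -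
l q + l.choose 2`.

Let `r` be the rank of the vectors `(1, u)`, `u ∈ X`. Freiman's inequality
(`Finset.finrank_span_mul_card_le`) gives `|X + X| ≥ r q - r.choose 2`. The right side is
nondecreasing in `r` on `0 ≤ r ≤ q`, so `l ≤ r` suffices (`mul_le_add_choose_two_of_le`). That bound
holds because `F(I)` is a quotient of the algebra generated by the monomials `x ^ u t`, whose
transcendence degree is at most `r` (`ringKrullDim_fiberRing_le`). -/

noncomputable section

open MvPolynomial

/-! ### Freiman's lower bound for the doubling of a finite set -/

open scoped Pointwise in
/-- **Freiman's inequality**: a finite set spanning a space of dimension `r` satisfies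
`|X + X| ≥ r |X| - r (r - 1) / 2`. -/
theorem Finset.finrank_span_mul_card_le {k V : Type*} [Field k] [AddCommGroup V] [LinearOrder V]
    [IsOrderedAddMonoid V] [Module k V] (X : Finset V) :
    Module.finrank k (Submodule.span k (X : Set V)) * X.card ≤
      (X + X).card + (Module.finrank k (Submodule.span k (X : Set V))).choose 2 := by
  classical
  induction X using Finset.induction_on_min with
  | empty => simp
  | insert v s hv ih =>
    have hvs : v ∉ s := fun h => lt_irrefl _ (hv v h)
    have hss : s + s ⊆ insert v s + insert v s :=
      Finset.add_subset_add (Finset.subset_insert _ _) (Finset.subset_insert _ _)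
    -- The induction adds a new minimum `v`; what remains is to count the sums `v + x` that are not
    -- already in `s + s`.
    have key : ∀ T ⊆ insert v s, (∀ x ∈ T, v + x ∉ s + s) →
        (s + s).card + T.card ≤ (insert v s + insert v s).card := by
      intro T hT hd
      rw [← Finset.card_image_of_injective T (add_right_injective v),
        ← Finset.card_union_of_disjoint]
      · refine Finset.card_le_card (Finset.union_subset hss ?_)
        intro y hy
        obtain ⟨x, hx, rfl⟩ := Finset.mem_image.mp hy
        exact Finset.add_mem_add (Finset.mem_insert_self _ _) (hT hx)
      · rw [Finset.disjoint_right]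
        intro y hy
        obtain ⟨x, hx, rfl⟩ := Finset.mem_image.mp hy
        exact hd x hx
    have hvv : v + v ∉ s + s := by
      intro h
      obtain ⟨a, ha, b, hb, hab⟩ := Finset.mem_add.mp h
      exact (add_lt_add (hv a ha) (hv b hb)).ne hab.symm
    have hspan : ∀ y ∈ s + s, y ∈ Submodule.span k (s : Set V) := by
      intro y hy
      obtain ⟨a, ha, b, hb, rfl⟩ := Finset.mem_add.mp hy
      exact add_mem (Submodule.subset_span ha) (Submodule.subset_span hb)
    rw [Finset.card_insert_of_notMem hvs, Finset.coe_insert]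
    by_cases hmem : v ∈ Submodule.span k (s : Set V)
    · have hr : Submodule.span k (insert v (s : Set V)) = Submodule.span k (s : Set V) :=
        Submodule.span_insert_eq_span hmem
      rw [hr]
      set D := s.filter fun x => v + x ∉ s + s
      have hvD : v ∉ D := fun h => hvs (Finset.mem_filter.mp h).1
      have h1 := key (insert v D) (Finset.insert_subset_insert _ (Finset.filter_subset _ _)) (by
        intro x hx
        rcases Finset.mem_insert.mp hx with rfl | hx
        · exact hvv
        · exact (Finset.mem_filter.mp hx).2)
      rw [Finset.card_insert_of_notMem hvD] at h1
      -- If the rank does not grow, `r` new sums are needed, so `v` and `D` must span. A least `x ∈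
      -- s` outside their span is not in `D`, so `v + x = y + z` with `y, z ∈ s`. As `v` is below
      -- both, `y, z < x`; they lie in the span, hence so does `x = y + z - v`.
      have hle : Submodule.span k (s : Set V) ≤
          Submodule.span k ((insert v D : Finset V) : Set V) := by
        rw [Submodule.span_le]
        by_contra hcon
        set B := s.filter fun x => x ∉ Submodule.span k ((insert v D : Finset V) : Set V)
        have hBne : B.Nonempty := by
          obtain ⟨x, hx, hx'⟩ := Set.not_subset.mp hcon
          exact ⟨x, Finset.mem_filter.mpr ⟨hx, hx'⟩⟩
        obtain ⟨x, hxB, hmin⟩ := B.exists_min_image id hBne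
        obtain ⟨hxs, hx⟩ := Finset.mem_filter.mp hxB
        have hvI : v ∈ Submodule.span k ((insert v D : Finset V) : Set V) :=
          Submodule.subset_span (by simp)
        have hsmall : ∀ y ∈ s, y < x → y ∈ Submodule.span k ((insert v D : Finset V) : Set V) := by
          intro y hy hyx
          by_contra h
          exact (hmin y (Finset.mem_filter.mpr ⟨hy, h⟩)).not_gt hyx
        have hxD : x ∉ D := fun h => hx (Submodule.subset_span (by simp [h]))
        have : v + x ∈ s + s := by
          by_contra h
          exact hxD (Finset.mem_filter.mpr ⟨hxs, h⟩)
        obtain ⟨y, hy, z, hz, hyz⟩ := Finset.mem_add.mp this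
        have hyx : y < x := by
          have := hv z hz
          by_contra! h
          exact (add_lt_add_of_lt_of_le this h).ne (by rw [← hyz, add_comm])
        have hzx : z < x := by
          have := hv y hy
          by_contra! h
          exact (add_lt_add_of_lt_of_le this h).ne hyz.symm
        apply hx
        have : x = y + z - v := by rw [hyz]; abel
        rw [this]
        exact sub_mem (add_mem (hsmall y hy hyx) (hsmall z hz hzx)) hvI
      have h2 : Module.finrank k (Submodule.span k (s : Set V)) ≤ D.card + 1 := by
        rw [← Finset.card_insert_of_notMem hvD]
        exact (Submodule.finrank_mono hle).trans (finrank_span_finset_le_card _)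
      linarith
    -- If the rank grows, every `v + x` is new, since `s + s` lies in the span of `s`. The `|s| + 1`
    -- new sums are exactly what the step from `r` to `r + 1` requires.
    · have h1 := key (insert v s) subset_rfl (by
        intro x hx h
        have h' := hspan _ h
        rcases Finset.mem_insert.mp hx with rfl | hx
        · exact hvv h
        · exact hmem ((Submodule.add_mem_iff_left _ (Submodule.subset_span hx)).mp h'))
      rw [Finset.card_insert_of_notMem hvs] at h1
      have hr : Module.finrank k (Submodule.span k (insert v (s : Set V))) =
          Module.finrank k (Submodule.span k (s : Set V)) + 1 := by
        rw [← Set.union_singleton, Submodule.span_union]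
        have hv0 : v ≠ 0 := fun h => hmem (h ▸ zero_mem _)
        have hinf : Submodule.span k (s : Set V) ⊓ Submodule.span k {v} = ⊥ := by
          rw [← disjoint_iff, Submodule.disjoint_span_singleton' hv0]
          exact hmem
        have := Submodule.finrank_sup_add_finrank_inf_eq (Submodule.span k (s : Set V))
          (Submodule.span k {v})
        rwa [hinf, finrank_bot, add_zero, finrank_span_singleton hv0] at this
      rw [hr, Nat.choose_succ_succ', Nat.choose_one_right]
      linarith

/-! ### Krull dimension and transcendence degree -/

/-- Incomparability: nested distinct primes contract to distinct primes, so strict chains stay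
strict. -/
theorem ringKrullDim_le_of_isIntegral {R S : Type*} [CommRing R] [CommRing S] (f : R →+* S)
    (hf : f.IsIntegral) : ringKrullDim S ≤ ringKrullDim R := by
  algebraize [f]
  refine Order.krullDim_le_of_strictMono (PrimeSpectrum.comap f) ?_
  intro p q hpq
  refine lt_of_le_of_ne (Ideal.comap_mono hpq.le) fun h => ?_
  have : p.asIdeal < q.asIdeal := hpq
  exact (Ideal.IsIntegral.comap_lt_comap (R := R) this).ne (congrArg PrimeSpectrum.asIdeal h)

/-- By Noether normalization `A` is integral over a polynomial subring, whose number of variables is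
at most the transcendence degree. -/
theorem ringKrullDim_le_of_trdeg_le {K A : Type*} [Field K] [CommRing A] [Nontrivial A] [Algebra K A]
    [Algebra.FiniteType K A] {r : ℕ} (h : Algebra.trdeg K A ≤ r) : ringKrullDim A ≤ r := by
  obtain ⟨s, g, hg, hint⟩ := exists_integral_inj_algHom_of_fg K A
  have h1 := ringKrullDim_le_of_isIntegral g.toRingHom hint
  rw [MvPolynomial.ringKrullDim_of_isNoetherianRing, ringKrullDim_eq_zero_of_field, zero_add,
    Nat.card_fin] at h1
  have h2 := lift_trdeg_le_of_injective g hg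
  have h3 : s ≤ r := by
    simpa [MvPolynomial.trdeg_of_isDomain] using h2.trans (Cardinal.lift_le.mpr h)
  exact h1.trans (by exact_mod_cast h3)

/-! ### Dimension of algebras generated by monomials -/

/-- After clearing denominators, a vector of a rational span is a difference of combinations
with natural number coefficients. -/
theorem exists_nsmul_add_linearCombination_eq {ι V : Type*} [AddCommGroup V] [Module ℚ V]
    (e : ι → V) {x : V} (hx : x ∈ Submodule.span ℚ (Set.range e)) :
    ∃ N : ℕ, 0 < N ∧ ∃ a b : ι →₀ ℕ,
      N • x + Finsupp.linearCombination ℕ e a = Finsupp.linearCombination ℕ e b := by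
  induction hx using Submodule.span_induction with
  | mem x h =>
    obtain ⟨i, rfl⟩ := h
    exact ⟨1, one_pos, 0, Finsupp.single i 1, by simp⟩
  | zero => exact ⟨1, one_pos, 0, 0, by simp⟩
  | add x y _ _ hx hy =>
    obtain ⟨N, hN, a, b, h⟩ := hx
    obtain ⟨M, hM, c, d, h'⟩ := hy
    refine ⟨N * M, Nat.mul_pos hN hM, M • a + N • c, M • b + N • d, ?_⟩
    simp only [map_add, map_nsmul, ← h, ← h']
    module
  | smul q x _ hx =>
    obtain ⟨N, hN, a, b, h⟩ := hx
    have hq : (q.den : ℚ) • q • x = (q.num : ℚ) • x := by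
      rw [smul_smul, Rat.den_mul_eq_num]
    have key : (N * q.den) • q • x = N • q.num • x := by
      rw [mul_smul, ← Nat.cast_smul_eq_nsmul ℚ q.den, hq, Int.cast_smul_eq_zsmul]
    refine ⟨N * q.den, Nat.mul_pos hN q.den_pos, ?_⟩
    obtain ⟨m, hm | hm⟩ := q.num.eq_nat_or_neg
    · refine ⟨m • a, m • b, ?_⟩
      rw [key, hm, map_nsmul, map_nsmul, ← h]
      module
    · refine ⟨m • b, m • a, ?_⟩
      rw [key, hm, map_nsmul, map_nsmul, ← h]
      module

/-- An algebra generated by elements `z i` whose monomials depend only on their weight, where `z i`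
has weight `e i`, has dimension at most the rank of the weights. -/
theorem ringKrullDim_le_finrank_span_of_prod_eq {K A ι V : Type*} [Field K] [CommRing A]
    [IsDomain A] [Algebra K A] [Finite ι] [AddCommGroup V] [Module ℚ V] (z : ι → A) (e : ι → V)
    (hz : ∀ i, z i ≠ 0) (hgen : Algebra.adjoin K (Set.range z) = ⊤)
    (hrel : ∀ a b : ι →₀ ℕ, Finsupp.linearCombination ℕ e a = Finsupp.linearCombination ℕ e b →
      (a.prod fun i m => z i ^ m) = b.prod fun i m => z i ^ m) :
    ringKrullDim A ≤ Module.finrank ℚ (Submodule.span ℚ (Set.range e)) := by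
  classical
  have : Algebra.FiniteType K A :=
    ⟨(Subalgebra.fg_def).mpr ⟨Set.range z, Set.finite_range z, hgen⟩⟩
  obtain ⟨b, hb, hspan, hlin⟩ := exists_linearIndependent ℚ (Set.range e)
  choose f hf using fun x : b => hb x.2
  have hbfin : Finite b := (Set.finite_range e).subset hb
  have : Fintype b := Fintype.ofFinite b
  have hcard : Module.finrank ℚ (Submodule.span ℚ (Set.range e)) = Nat.card b := by
    rw [← hspan, finrank_span_set_eq_card hlin, Set.toFinset_card, Nat.card_eq_fintype_card]
  have hef : Set.range (fun x => e (f x)) = b := by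
    simp only [hf, Subtype.range_coe]
  let B : Subalgebra K A := Algebra.adjoin K (Set.range fun x => z (f x))
  have hprod : ∀ c : b →₀ ℕ, (c.prod fun x m => z (f x) ^ m) ∈ B := fun c =>
    B.prod_mem fun x _ => B.pow_mem (Algebra.subset_adjoin ⟨x, rfl⟩) _
  have halg : ∀ i, IsAlgebraic B (z i) := by
    intro i
    have hi : e i ∈ Submodule.span ℚ (Set.range fun x => e (f x)) := by
      rw [hef, hspan]
      exact Submodule.subset_span ⟨i, rfl⟩
    obtain ⟨N, hN, c, d, h⟩ := exists_nsmul_add_linearCombination_eq _ hi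
    -- A rational dependence of `e i` on the basis weights becomes `z i ^ N * z ^ c = z ^ d`. This
    -- is an algebraic equation for `z i` over `B`, with leading coefficient `z ^ c ≠ 0` because `A`
    -- is a domain.
    have h' := hrel (Finsupp.single i N + c.mapDomain f) (d.mapDomain f) (by
      rw [map_add, Finsupp.linearCombination_mapDomain, Finsupp.linearCombination_mapDomain,
        Finsupp.linearCombination_single]
      exact h)
    rw [Finsupp.prod_add_index' (by simp) (by intros; rw [pow_add]),
      Finsupp.prod_mapDomain_index (by simp) (by intros; rw [pow_add]),
      Finsupp.prod_mapDomain_index (by simp) (by intros; rw [pow_add]),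
      Finsupp.prod_single_index (by simp)] at h'
    set p : B := ⟨_, hprod c⟩
    set q : B := ⟨_, hprod d⟩
    have hp0 : p ≠ 0 := by
      intro h0
      have : (c.prod fun x m => z (f x) ^ m) = 0 := congrArg Subtype.val h0
      exact Finset.prod_ne_zero_iff.mpr (fun x _ => pow_ne_zero _ (hz _)) this
    refine ⟨Polynomial.C p * Polynomial.X ^ N - Polynomial.C q, ?_, ?_⟩
    · intro h0
      have := congrArg (fun P => Polynomial.coeff P N) h0
      simp [Polynomial.coeff_C, hN.ne', hp0] at this
    · simp only [map_sub, map_mul, map_pow, Polynomial.aeval_C, Polynomial.aeval_X]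
      change (c.prod fun x m => z (f x) ^ m) * z i ^ N - (d.prod fun x m => z (f x) ^ m) = 0
      rw [← h', mul_comm, sub_self]
  have : Algebra.IsAlgebraic B A := by
    refine ⟨fun a => ?_⟩
    have ha : a ∈ Algebra.adjoin K (Set.range z) := hgen ▸ Algebra.mem_top
    induction ha using Algebra.adjoin_induction with
    | mem x hx =>
      obtain ⟨i, rfl⟩ := hx
      exact halg i
    | algebraMap r => exact isAlgebraic_algebraMap (algebraMap K B r)
    | add x y _ _ hx hy => exact hx.add hy
    | mul x y _ _ hx hy => exact hx.mul hy
  rw [hcard]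
  refine ringKrullDim_le_of_trdeg_le (K := K) ((Algebra.IsAlgebraic.trdeg_le_cardinalMk K
    (Set.range fun x => z (f x))).trans ?_)
  rw [← Nat.cast_card]
  exact_mod_cast Finite.card_range_le _

/-! ### Graded components of the fiber ring -/

section Fiber

variable {K : Type*} [Field K] {n : ℕ}

theorem IsMonomialIdeal.exists_finset_of_isEquigenerated {I : Ideal (MvPolynomial (Fin n) K)}
    (hmon : IsMonomialIdeal I) (heq : IsEquigenerated I) :
    ∃ (d : ℕ) (X : Finset (Fin n →₀ ℕ)), (∀ u ∈ X, u.degree = d) ∧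
      I = Ideal.span ((fun a => monomial a (1 : K)) '' (X : Set (Fin n →₀ ℕ))) := by
  obtain ⟨A, hA⟩ := hmon
  obtain ⟨d, G, hG, hI⟩ := heq
  -- These exponents generate: a monomial ideal contains every monomial occurring in its elements,
  -- in particular those of the degree `d` generators in `G`.
  have hfin : {u : Fin n →₀ ℕ | u.degree = d ∧ monomial u (1 : K) ∈ I}.Finite :=
    ((Finset.finite_toSet (Finset.univ.finsuppAntidiag d)).subset fun u hu => by
      simpa [Finsupp.degree_eq_sum] using hu.1)
  refine ⟨d, hfin.toFinset, fun u hu => (hfin.mem_toFinset.mp hu).1, le_antisymm ?_ ?_⟩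
  · conv_lhs => rw [hI]
    rw [Ideal.span_le]
    intro g hg
    have hgI : g ∈ I := hI ▸ Ideal.subset_span hg
    rw [hA, mem_ideal_span_monomial_image] at hgI
    refine mem_ideal_span_monomial_image.mpr fun u hu => ⟨u, ?_, le_rfl⟩
    rw [hfin.coe_toFinset]
    refine ⟨?_, ?_⟩
    · have := hG g hg (mem_support_iff.mp hu)
      rwa [Finsupp.degree_eq_weight_one]
    · rw [hA, mem_ideal_span_monomial_image]
      intro v hv
      have : v = u := by simpa using support_monomial_subset hv
      exact this ▸ hgI u hu
  · rw [Ideal.span_le]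
    rintro _ ⟨u, hu, rfl⟩
    exact (hfin.mem_toFinset.mp hu).2

variable (I : Ideal (MvPolynomial (Fin n) K))

/-- The element `f tᵏ` of the fiber ring, for `f ∈ Iᵏ`. -/
def fiberMonomial (k : ℕ) (f : MvPolynomial (Fin n) K) (hf : f ∈ I ^ k) : FiberRing I :=
  Ideal.Quotient.mk _ ⟨Polynomial.monomial k f, reesAlgebra.monomial_mem.mpr hf⟩

theorem fiberMonomial_mem (k : ℕ) (f : MvPolynomial (Fin n) K) (hf : f ∈ I ^ k) :
    fiberMonomial I k f hf ∈ fiberComponent I k :=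
  ⟨_, ⟨f, hf, rfl⟩, rfl⟩

/-- Polynomials act on `F(I)` through their constant term, which is why ideal generators of `I ^ k`
span the `k`-th component over `K`. -/
theorem mk_algebraMap_eq (f : MvPolynomial (Fin n) K) :
    Ideal.Quotient.mk (irrelevantReesIdeal I) (algebraMap _ (reesAlgebra I) f) =
      algebraMap K (FiberRing I) (constantCoeff f) := by
  have h : f - C (constantCoeff f) ∈ idealOfVars (Fin n) K := by
    rw [← pow_one (idealOfVars (Fin n) K), mem_pow_idealOfVars_iff']
    intro x hx
    have : x = 0 := by
      rw [← Finsupp.degree_eq_zero_iff]; omega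
    subst this
    simp [constantCoeff_eq]
  have h2 := Ideal.mem_map_of_mem (algebraMap _ (reesAlgebra I)) h
  rw [map_sub] at h2
  rw [(Ideal.Quotient.eq).mpr h2]
  rfl

theorem coeff_mem_of_mem_irrelevantReesIdeal {x : reesAlgebra I} (hx : x ∈ irrelevantReesIdeal I)
    (k : ℕ) : (x : Polynomial (MvPolynomial (Fin n) K)).coeff k ∈ idealOfVars (Fin n) K * I ^ k := by
  rw [irrelevantReesIdeal, Ideal.map] at hx
  induction hx using Submodule.span_induction generalizing k with
  | mem x h =>
    obtain ⟨f, hf, rfl⟩ := h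
    change (Polynomial.C f).coeff k ∈ _
    rw [Polynomial.coeff_C]
    split_ifs with h
    · subst h; simpa using hf
    · exact zero_mem _
  | zero => simp
  | add x y _ _ hx hy => simpa using add_mem (hx k) (hy k)
  | smul r x _ hx =>
    rw [smul_eq_mul, Subalgebra.coe_mul, Polynomial.coeff_mul]
    refine sum_mem fun p hp => ?_
    rw [← Finset.HasAntidiagonal.mem_antidiagonal.mp hp, pow_add, mul_left_comm]
    exact Ideal.mul_mem_mul ((mem_reesAlgebra_iff I _).mp r.2 _) (hx _)

/-- The coefficient of `x ^ w tᵏ`, which descends to the fiber ring if `Iᵏ ⊆ 𝔪 ^ |w|`. -/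
def fiberCoeff (k : ℕ) (w : Fin n →₀ ℕ) (h : I ^ k ≤ idealOfVars (Fin n) K ^ w.degree) :
    FiberRing I →ₗ[K] K :=
  ((irrelevantReesIdeal I).restrictScalars K).liftQ
    (lcoeff K w ∘ₗ ((Polynomial.lcoeff (MvPolynomial (Fin n) K) k).restrictScalars K) ∘ₗ
      ((reesAlgebra I).val.toLinearMap.restrictScalars K)) (by
    intro x hx
    have h1 := coeff_mem_of_mem_irrelevantReesIdeal I hx k
    have h2 : (x : Polynomial (MvPolynomial (Fin n) K)).coeff k ∈ idealOfVars (Fin n) K ^ (w.degree + 1) := by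
      rw [pow_succ']
      exact Ideal.mul_mono_right h h1
    exact (mem_pow_idealOfVars_iff' _ _).mp h2 w (Nat.lt_succ_self _))

theorem fiberCoeff_fiberMonomial (k : ℕ) (w : Fin n →₀ ℕ)
    (h : I ^ k ≤ idealOfVars (Fin n) K ^ w.degree) (f : MvPolynomial (Fin n) K) (hf : f ∈ I ^ k) :
    fiberCoeff I k w h (fiberMonomial I k f hf) = coeff w f := by
  change coeff w ((Polynomial.monomial k f).coeff k) = _
  rw [Polynomial.coeff_monomial_same]

variable {I}

theorem span_fiberMonomial {k : ℕ} {Y : Set (Fin n →₀ ℕ)}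
    (hY : I ^ k = Ideal.span ((fun a => monomial a (1 : K)) '' Y)) :
    Submodule.span K (Set.range fun w : Y => fiberMonomial I k (monomial w.1 1)
      (hY ▸ Ideal.subset_span ⟨w.1, w.2, rfl⟩)) = fiberComponent I k := by
  refine le_antisymm ?_ ?_
  · rw [Submodule.span_le]
    rintro _ ⟨w, rfl⟩
    exact fiberMonomial_mem ..
  · rintro _ ⟨x, ⟨f, hf, hx⟩, rfl⟩
    have hx' : x = ⟨Polynomial.monomial k f, reesAlgebra.monomial_mem.mpr hf⟩ := Subtype.ext hx
    subst hx'
    clear hx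
    change fiberMonomial I k f hf ∈ _
    have hf' := hf
    rw [hY] at hf'
    induction hf' using Submodule.span_induction with
    | mem x h =>
      obtain ⟨w, hw, rfl⟩ := h
      exact Submodule.subset_span ⟨⟨w, hw⟩, rfl⟩
    | zero =>
      convert Submodule.zero_mem _
      rw [fiberMonomial, ← map_zero (Ideal.Quotient.mk (irrelevantReesIdeal I))]
      congr 1
      exact Subtype.ext (map_zero _)
    | add x y hx hy ihx ihy =>
      convert add_mem (ihx (hY ▸ hx)) (ihy (hY ▸ hy)) using 1
      rw [fiberMonomial, fiberMonomial, fiberMonomial, ← map_add]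
      congr 1
      exact Subtype.ext (map_add _ _ _)
    | smul r x hx ih =>
      convert Submodule.smul_mem _ (constantCoeff r) (ih (hY ▸ hx)) using 1
      refine Eq.trans ?_
        (Algebra.smul_def (constantCoeff r) (fiberMonomial I k x (hY ▸ hx))).symm
      rw [← mk_algebraMap_eq, fiberMonomial, fiberMonomial, ← map_mul]
      congr 1
      refine Subtype.ext ?_
      change _ = Polynomial.C r * Polynomial.monomial k x
      rw [Polynomial.C_mul_monomial]
      rfl

/-- Independence uses the common degree `D`: since `I ^ k ⊆ 𝔪 ^ D`, elements of `𝔪 I ^ k` have no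
terms of degree `D`, so coefficients in that degree are well defined on the fiber ring. -/
theorem finrank_fiberComponent {k D : ℕ} {Y : Finset (Fin n →₀ ℕ)} (hD : ∀ w ∈ Y, w.degree = D)
    (hY : I ^ k = Ideal.span ((fun a => monomial a (1 : K)) '' (Y : Set (Fin n →₀ ℕ)))) :
    Module.finrank K (fiberComponent I k) = Y.card := by
  classical
  have hle : ∀ w ∈ Y, I ^ k ≤ idealOfVars (Fin n) K ^ w.degree := by
    intro w hw
    rw [hY, Ideal.span_le]
    rintro _ ⟨v, hv, rfl⟩
    exact (monomial_mem_pow_idealOfVars_iff _ _ one_ne_zero).mpr (by rw [hD w hw, hD v hv])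
  rw [← span_fiberMonomial hY, finrank_span_eq_card]
  · simp
  · rw [Fintype.linearIndependent_iff]
    intro g hg w
    have := congrArg (fiberCoeff I k w.1 (hle _ w.2)) hg
    simp only [map_sum, map_smul, fiberCoeff_fiberMonomial, coeff_monomial, map_zero, smul_eq_mul,
      mul_ite, mul_one, mul_zero] at this
    rw [Finset.sum_eq_single w (fun v _ hv => if_neg fun h => hv (Subtype.ext h))
      (fun h => (h (Finset.mem_univ _)).elim), if_pos rfl] at this
    exact this

end Fiber

/-! ### The analytic spread is at most the rank of the exponents -/

section Spread

variable {K : Type*} [Field K] {n : ℕ}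

/-- The monomials `x ^ u tᵏ` of `S[t]`, multiplicatively in `(k, u)`. -/
def biMonomial (K : Type*) [Field K] (n : ℕ) :
    Multiplicative (ℕ × (Fin n →₀ ℕ)) →* Polynomial (MvPolynomial (Fin n) K) where
  toFun p := Polynomial.monomial p.toAdd.1 (monomial p.toAdd.2 1)
  map_one' := rfl
  map_mul' p q := by
    rw [Polynomial.monomial_mul_monomial, monomial_mul, one_mul]
    rfl

/-- The bound is proved for the subalgebra `A` of the Rees ring generated by the `x ^ u t`. It is a
domain inside `S[t]`, where monomial relations can be read off from exponents, and it maps onto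
`F(I)`. -/
theorem ringKrullDim_fiberRing_le {I : Ideal (MvPolynomial (Fin n) K)}
    {X : Finset (Fin n →₀ ℕ)}
    (hX : I = Ideal.span ((fun a => monomial a (1 : K)) '' (X : Set (Fin n →₀ ℕ))))
    {V : Type*} [AddCommGroup V] [Module ℚ V] (W : ℕ × (Fin n →₀ ℕ) →+ V)
    (hW : Function.Injective W) :
    ringKrullDim (FiberRing I) ≤
      Module.finrank ℚ (Submodule.span ℚ (Set.range fun u : X => W (1, u.1))) := by
  have hmem : ∀ u : X, monomial u.1 (1 : K) ∈ I ^ 1 := fun u => by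
    rw [pow_one, hX]
    exact Ideal.subset_span ⟨u.1, u.2, rfl⟩
  let y : X → reesAlgebra I := fun u =>
    ⟨Polynomial.monomial 1 (monomial u.1 (1 : K)), reesAlgebra.monomial_mem.mpr (hmem u)⟩
  let A : Subalgebra K (reesAlgebra I) := Algebra.adjoin K (Set.range y)
  let z : X → A := fun u => ⟨y u, Algebra.subset_adjoin ⟨u, rfl⟩⟩
  let ψ : A →ₐ[K] FiberRing I := (Ideal.Quotient.mkₐ K (irrelevantReesIdeal I)).comp A.val
  have hψ : Function.Surjective ψ := by
    rw [← AlgHom.range_eq_top]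
    have hone : ∀ f (hf : f ∈ I ^ 1), fiberMonomial I 1 f hf ∈ ψ.range := by
      intro f hf
      have h1 := fiberMonomial_mem I 1 f hf
      rw [← span_fiberMonomial (Y := (X : Set (Fin n →₀ ℕ))) (by rw [pow_one, ← hX])] at h1
      refine (Submodule.span_le (p := Subalgebra.toSubmodule ψ.range)).mpr ?_ h1
      rintro _ ⟨u, rfl⟩
      exact ⟨z u, rfl⟩
    rw [eq_top_iff]
    rintro x -
    obtain ⟨⟨f, hf⟩, rfl⟩ := Ideal.Quotient.mk_surjective x
    have hf' := hf
    rw [← adjoin_monomial_eq_reesAlgebra] at hf'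
    induction hf' using Algebra.adjoin_induction with
    | mem g hg =>
      obtain ⟨r, hr, rfl⟩ := hg
      exact hone r (by rwa [pow_one])
    | algebraMap r =>
      have : Ideal.Quotient.mk (irrelevantReesIdeal I) ⟨_, hf⟩ = _ := mk_algebraMap_eq I r
      rw [this]
      exact Subalgebra.algebraMap_mem _ _
    | add g h hg hh ihg ihh =>
      rw [adjoin_monomial_eq_reesAlgebra] at hg hh
      exact add_mem (ihg hg) (ihh hh)
    | mul g h hg hh ihg ihh =>
      rw [adjoin_monomial_eq_reesAlgebra] at hg hh
      exact mul_mem (ihg hg) (ihh hh)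
  refine (ringKrullDim_le_of_surjective ψ.toRingHom hψ).trans ?_
  let c : A →+* Polynomial (MvPolynomial (Fin n) K) :=
    (reesAlgebra I).val.toRingHom.comp A.val.toRingHom
  have hc : Function.Injective c := Subtype.val_injective.comp Subtype.val_injective
  have hprod : ∀ a : X →₀ ℕ, c (a.prod fun u m => z u ^ m) = biMonomial K n
      (Multiplicative.ofAdd (Finsupp.linearCombination ℕ (fun u : X => (1, u.1)) a)) := by
    intro a
    rw [Finsupp.linearCombination_apply, Finsupp.sum, ofAdd_sum, map_prod, Finsupp.prod, map_prod]
    refine Finset.prod_congr rfl fun u _ => ?_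
    rw [ofAdd_nsmul, map_pow, map_pow]
    rfl
  refine ringKrullDim_le_finrank_span_of_prod_eq (K := K) z _ ?_ ?_ ?_
  · intro u h
    have : c (z u) = 0 := by rw [h, map_zero]
    change Polynomial.monomial 1 (monomial u.1 (1 : K)) = 0 at this
    simp at this
  · have hr : Set.range z = ((↑) : A → reesAlgebra I) ⁻¹' Set.range y := by
      refine Set.ext fun a => ⟨?_, ?_⟩
      · rintro ⟨u, rfl⟩
        exact ⟨u, rfl⟩
      · rintro ⟨u, hu⟩
        exact ⟨u, Subtype.ext hu⟩
    rw [hr]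
    exact Algebra.adjoin_adjoin_coe_preimage
  · intro a b hab
    apply hc
    rw [hprod, hprod]
    have h : ∀ a : X →₀ ℕ, Finsupp.linearCombination ℕ (fun u : X => W (1, u.1)) a =
        W (Finsupp.linearCombination ℕ (fun u : X => (1, u.1)) a) := by
      intro a
      simp only [Finsupp.linearCombination_apply, Finsupp.sum, map_sum, map_nsmul]
    rw [h, h] at hab
    rw [hW hab]

end Spread

/-! ### Nonnegativity of the second entry of the `h`-vector -/

theorem coeff_two_one_sub_X_pow_mul (l : ℕ) (f : PowerSeries ℤ) :
    PowerSeries.coeff 2 ((1 - PowerSeries.X) ^ l * f) =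
      PowerSeries.coeff 2 f - l * PowerSeries.coeff 1 f + l.choose 2 * PowerSeries.coeff 0 f := by
  induction l generalizing f with
  | zero => simp
  | succ l ih =>
    rw [pow_succ, mul_assoc, ih, Nat.choose_succ_succ', Nat.choose_one_right, sub_mul, one_mul]
    simp only [map_sub, PowerSeries.coeff_zero_X_mul, show (2 : ℕ) = 1 + 1 from rfl,
      PowerSeries.coeff_succ_X_mul, show PowerSeries.coeff 1 (PowerSeries.X * f) =
        PowerSeries.coeff 0 f from PowerSeries.coeff_succ_X_mul 0 f]
    push_cast
    ring

/-- Passing from `r + 1` to `r` lowers `r q - r.choose 2` by `q - r`, which is nonnegative for `r ≤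
q`. -/
theorem mul_le_add_choose_two_of_le {l r q s : ℕ} (hlr : l ≤ r) (hrq : r ≤ q)
    (h : r * q ≤ s + r.choose 2) : l * q ≤ s + l.choose 2 := by
  induction r, hlr using Nat.le_induction with
  | base => exact h
  | succ r _ ih =>
    refine ih (by omega) ?_
    rw [Nat.choose_succ_succ', Nat.choose_one_right] at h
    linarith

/-- The exponent vector of `x ^ u tᵏ`, in a lexicographically ordered rational vector space. -/
def exponentVector (n : ℕ) : ℕ × (Fin n →₀ ℕ) →+ Lex (Fin (n + 1) → ℚ) where
  toFun p := toLex (Fin.cons (p.1 : ℚ) fun i => (p.2 i : ℚ))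
  map_zero' := by
    rw [← toLex_zero]
    congr 1
    ext i
    cases i using Fin.cases <;> simp
  map_add' p q := by
    rw [← toLex_add]
    congr 1
    ext i
    cases i using Fin.cases <;> simp

theorem exponentVector_injective (n : ℕ) : Function.Injective (exponentVector n) := by
  intro p q h
  have h' : (Fin.cons (p.1 : ℚ) fun i => (p.2 i : ℚ)) =
      (Fin.cons (q.1 : ℚ) fun i => (q.2 i : ℚ) : Fin (n + 1) → ℚ) := toLex.injective h
  obtain ⟨h1, h2⟩ := Fin.cons_inj.mp h'
  refine Prod.ext (by exact_mod_cast h1) (Finsupp.ext fun i => ?_)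
  exact_mod_cast congrFun h2 i

open scoped Pointwise in
theorem span_monomial_pow_two {K : Type*} [Field K] {n : ℕ} [DecidableEq (Fin n →₀ ℕ)]
    (X : Finset (Fin n →₀ ℕ)) :
    Ideal.span ((fun a => monomial a (1 : K)) '' (X : Set (Fin n →₀ ℕ))) ^ 2 =
      Ideal.span ((fun a => monomial a (1 : K)) '' ((X + X : Finset _) : Set (Fin n →₀ ℕ))) := by
  rw [sq, Ideal.span_mul_span', Finset.coe_add]
  congr 1
  ext f
  simp only [Set.mem_mul, Set.mem_image, Set.mem_add]
  constructor
  · rintro ⟨_, ⟨u, hu, rfl⟩, _, ⟨v, hv, rfl⟩, rfl⟩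
    exact ⟨u + v, ⟨u, hu, v, hv, rfl⟩, by rw [monomial_mul, one_mul]⟩
  · rintro ⟨_, ⟨u, hu, v, hv, rfl⟩, rfl⟩
    exact ⟨_, ⟨u, hu, rfl⟩, _, ⟨v, hv, rfl⟩, by rw [monomial_mul, one_mul]⟩

end

open MvPolynomial in
open scoped Pointwise in
theorem corollary2p6 {K : Type*} [Field K] {n : ℕ} (I : Ideal (MvPolynomial (Fin n) K))
    (hmon : IsMonomialIdeal I) (heq : IsEquigenerated I) :
    0 ≤ fiberHVector I 2 := by
  classical
  obtain ⟨d, X, hd, hX⟩ := hmon.exists_finset_of_isEquigenerated heq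
  have h0 : Module.finrank K (fiberComponent I 0) = 1 := by
    rw [finrank_fiberComponent (Y := {0}) (D := 0) (by simp) (by
      simp only [Finset.coe_singleton, Set.image_singleton, pow_zero, Ideal.one_eq_top]
      exact (Ideal.span_singleton_one).symm), Finset.card_singleton]
  have h1 : Module.finrank K (fiberComponent I 1) = X.card :=
    finrank_fiberComponent hd (by rw [pow_one, ← hX])
  have h2 : Module.finrank K (fiberComponent I 2) = (X + X).card := by
    refine finrank_fiberComponent (D := d + d) ?_ (by rw [← span_monomial_pow_two, ← hX])
    intro w hw
    obtain ⟨u, hu, v, hv, rfl⟩ := Finset.mem_add.mp hw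
    rw [map_add, hd u hu, hd v hv]
  -- The leading coordinate `1` records the power of `t`. It matters for `X = {0}`: there `I = S`
  -- and `F(I) = K[t]` has dimension `1`, while the bare exponent has rank `0`. The lexicographic
  -- order serves Freiman's inequality.
  let e : (Fin n →₀ ℕ) → Lex (Fin (n + 1) → ℚ) := fun u => exponentVector n (1, u)
  have he : Function.Injective e := fun u v h => by
    simpa using exponentVector_injective n h
  have hspan : Set.range (fun u : X => e u.1) = (X.image e : Set (Lex (Fin (n + 1) → ℚ))) := by
    ext v; simp
  have hrank := ringKrullDim_fiberRing_le hX _ (exponentVector_injective n)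
  change _ ≤ ((Module.finrank ℚ (Submodule.span ℚ (Set.range fun u : X => e u.1)) : ℕ) :
    WithBot ℕ∞) at hrank
  rw [hspan, ← coe_analyticSpread] at hrank
  have hlr : analyticSpread I ≤
      Module.finrank ℚ (Submodule.span ℚ (X.image e : Set (Lex (Fin (n + 1) → ℚ)))) := by
    exact_mod_cast hrank
  have hrq := finrank_span_finset_le_card (R := ℚ) (X.image e)
  have hadd : (X.image e + X.image e).card = (X + X).card := by
    have : X.image e + X.image e = (X + X).image fun w => exponentVector n (2, w) := by
      ext w
      simp only [Finset.mem_add, Finset.mem_image]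
      constructor
      · rintro ⟨_, ⟨u, hu, rfl⟩, _, ⟨v, hv, rfl⟩, rfl⟩
        exact ⟨u + v, ⟨u, hu, v, hv, rfl⟩, map_add (exponentVector n) (1, u) (1, v)⟩
      · rintro ⟨_, ⟨u, hu, v, hv, rfl⟩, rfl⟩
        exact ⟨_, ⟨u, hu, rfl⟩, _, ⟨v, hv, rfl⟩, (map_add (exponentVector n) (1, u) (1, v)).symm⟩
    rw [this, Finset.card_image_of_injective]
    intro u v h
    simpa using exponentVector_injective n h
  have hF : Module.finrank ℚ (Submodule.span ℚ (X.image e : Set (Lex (Fin (n + 1) → ℚ)))) * X.card ≤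
      (X + X).card + (Module.finrank ℚ (Submodule.span ℚ
        (X.image e : Set (Lex (Fin (n + 1) → ℚ))))).choose 2 := by
    rw [← hadd, ← Finset.card_image_of_injective X he]
    convert (X.image e).finrank_span_mul_card_le (k := ℚ)
    rfl
  rw [Set.finrank, Finset.card_image_of_injective _ he] at hrq
  have := mul_le_add_choose_two_of_le hlr hrq hF
  rw [fiberHVector, coeff_two_one_sub_X_pow_mul]
  simp only [fiberHilbertSeries, PowerSeries.coeff_mk, h0, h1, h2]
  zify at this
  push_cast
  linarith
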